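/- Identify a spherical $d$-polytope $\mathcal P\subset\mathbb S^d$ with the full-dimensional polyhedral cone $\mathcal K\subset\mathbb R^{d+1}$, containing no line, such that $\mathcal P=\mathcal K\cap\mathbb S^d$; its faces are the intersections with supporting hyperplanes, and its combinatorial type is its face lattice. (Every Euclidean $d$-polytope has the combinatorial type of a spherical one, and conversely.) Let $$\mathcal B=\{x\in\mathbb S^d : -x_0^2+x_1^2+\dots+x_d^2\le 0,\ x_0\ge 0\},$$ a spherical cap with boundary sphere $\mathcal S$. A proper face $F$ of $\mathcal P$ \emph{strongly cuts} $\mathcal S$ if $\operatorname{relint}(F)\cap\mathcal B\neq\emptyset$, and \emph{strongly avoids} $\mathcal S$ if there is a supporting hyperplane $H$ of $\mathcal P$ with $F=H\cap\mathcal P$ such that $\mathcal B$ lies in the closed half-space bounded by $H$ that contains $\mathcal P$. For $0\le i\le j\le d-1$, a spherical $d$-polytope is \emph{$(i,j)$-scribed} if all its $i$-faces strongly avoid $\mathcal S$ and all its $j$-faces strongly cut $\mathcal S$; a $d$-polytope is \emph{$(i,j)$-scribable} if some spherical $d$-polytope with an isomorphic face lattice is $(i,j)$-scribed. A polytope is \emph{$k$-neighborly}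 if every $k$ of its vertices form a face, i.e. are exactly the vertices of a face. \textbf{Proposition.} Let $d\ge 4$ and $2\le k\le d-1$. There is a number $N=N(d,k)$ such that no $k$-neighborly $d$-polytope with at least $N$ vertices is $(1,k)$-scribable. -/

import Mathlib

noncomputable section

/-- The vector space `ℝ^{d+1}`, with coordinates `x 0, …, x d`; it carries its Euclidean norm
(which defines `𝕊^d`) and, through `lorentzProd`, the structure of the Lorentzian space. -/
abbrev LorentzSpace (d : ℕ) : Type := EuclideanSpace ℝ (Fin (d + 1))

/-- The Lorentzian scalar product `-x₀y₀ + x₁y₁ + ⋯ + x_d y_d`. -/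
def lorentzProd {d : ℕ} (x y : LorentzSpace d) : ℝ :=
  -(x 0 * y 0) + ∑ i : Fin d, x i.succ * y i.succ

/-- The (solid, future) light cone. -/
def lightCone (d : ℕ) : Set (LorentzSpace d) :=
  {x | lorentzProd x x ≤ 0 ∧ 0 ≤ x 0}

/-- The spherical cap `𝓑 = 𝓛 ∩ 𝕊^d`; its boundary is the sphere `𝓢` of the scribability
problems. -/
def ballB (d : ℕ) : Set (LorentzSpace d) :=
  lightCone d ∩ Metric.sphere 0 1

/-- A `d`-polytope in the sphere `𝕊^d`, given by the pointed polyhedral cone `cone` in `ℝ^{d+1}`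
of which it is the intersection with `𝕊^d`. The cone is the conical hull of finitely many vectors
(`polyhedral`), contains no line (`salient`), and is full-dimensional (`fullDim`). -/
structure SphericalPolytope (d : ℕ) where
  cone : PointedCone ℝ (LorentzSpace d)
  polyhedral : cone.FG
  salient : (cone : ConvexCone ℝ (LorentzSpace d)).Salient
  fullDim : Submodule.span ℝ (cone : Set (LorentzSpace d)) = ⊤

namespace SphericalPolytope

variable {d : ℕ}

/-- `F` is (the cone over) a face of `P`: the cone of `P` lies in the half-space `ℓ ≤ 0`, and `F`
is its intersection with `ℓ = 0`. The two trivial faces are included: the empty face of the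
spherical polytope, whose cone is `{0}`, and `P` itself (`ℓ = 0`). -/
def IsFace (P : SphericalPolytope d) (F : Set (LorentzSpace d)) : Prop :=
  ∃ ℓ : LorentzSpace d →ₗ[ℝ] ℝ,
    (∀ x ∈ P.cone, ℓ x ≤ 0) ∧ F = {x | x ∈ P.cone ∧ ℓ x = 0}

/-- A `k`-face: a face whose span in `𝕊^d` is `k`-dimensional, that is, whose cone has a
`(k+1)`-dimensional linear span. -/
def IsKFace (P : SphericalPolytope d) (k : ℕ) (F : Set (LorentzSpace d)) : Prop :=
  P.IsFace F ∧ Module.finrank ℝ (Submodule.span ℝ F) = k + 1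

/-- The face lattice, ordered by inclusion. -/
abbrev FaceLattice (P : SphericalPolytope d) : Type :=
  {F : Set (LorentzSpace d) // P.IsFace F}

/-- Same combinatorial type: `Q` is a realization of (the combinatorial type of) `P`. -/
def CombEquiv (P Q : SphericalPolytope d) : Prop :=
  Nonempty (P.FaceLattice ≃o Q.FaceLattice)

/-- The vertices of `P`, as points of `𝕊^d` (each `0`-face is the cone over exactly one). -/
def vertices (P : SphericalPolytope d) : Set (LorentzSpace d) :=
  {v | v ∈ Metric.sphere (0 : LorentzSpace d) 1 ∧ ∃ F, P.IsKFace 0 F ∧ v ∈ F}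

/-- Every `k` vertices form a face, i.e. are precisely the vertices of some face. -/
def IsNeighborly (P : SphericalPolytope d) (k : ℕ) : Prop :=
  ∀ I : Finset (LorentzSpace d), (I : Set (LorentzSpace d)) ⊆ P.vertices → I.card = k →
    ∃ F, P.IsFace F ∧ F ∩ P.vertices = (I : Set (LorentzSpace d))

/-- The face `F` strongly cuts the sphere: `relint F ∩ 𝓑 ≠ ∅`. -/
def StronglyCuts (F : Set (LorentzSpace d)) : Prop :=
  (intrinsicInterior ℝ F ∩ ballB d).Nonempty

/-- The face `F` of `P` strongly avoids the sphere: there is a supporting hyperplane `ℓ = 0` of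
`P` that meets `P` exactly in `F`, and `𝓑` lies in the half-space `ℓ ≤ 0` that contains `P`. -/
def StronglyAvoids (P : SphericalPolytope d) (F : Set (LorentzSpace d)) : Prop :=
  ∃ ℓ : LorentzSpace d →ₗ[ℝ] ℝ, ℓ ≠ 0 ∧
    (∀ x ∈ P.cone, ℓ x ≤ 0) ∧ F = {x | x ∈ P.cone ∧ ℓ x = 0} ∧ ∀ x ∈ ballB d, ℓ x ≤ 0

/-- `P` is (strongly) `(i,j)`-scribed: every `i`-face avoids and every `j`-face cuts the sphere. -/
def IsScribed (P : SphericalPolytope d) (i j : ℕ) : Prop :=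
  (∀ F, P.IsKFace i F → P.StronglyAvoids F) ∧ (∀ F, P.IsKFace j F → StronglyCuts F)

/-- The combinatorial type of `P` is (strongly) `(i,j)`-scribable: it has an `(i,j)`-scribed
realization. The notion is used for `0 ≤ i ≤ j ≤ d - 1`. -/
def IsScribable (P : SphericalPolytope d) (i j : ℕ) : Prop :=
  ∃ Q : SphericalPolytope d, P.CombEquiv Q ∧ Q.IsScribed i j

end SphericalPolytope

end

/-! Suppose a realization is $(1,k)$-scribed and has very many vertices. The aim is a $k$-face that
misses the ball.

Since $k\ge 2$, any two vertices $v,w$ span an edge. It avoids the sphere, so its supporting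
hyperplane is $y^\perp$ (Lorentzian) for some nonzero $y$ in the self-dual light cone
(`exists_lightlike_of_edge`). This forces the vertices to be spacelike, and, once they are
normalized to $\langle v,v\rangle=1$, gives $|\langle v,w\rangle|\le 1$, because the form is
positive semidefinite on $y^\perp$. Each vertex thus defines a hyperbolic half-space $\{y:\langle
y,v\rangle>0\}$, and the boundaries meet pairwise, possibly at infinity.

For such a family some hyperbolic point $p$ is at bounded distance from all the half-spaces
(`exists_center`). After a Lorentz transformation that makes $p$ the time axis, the vertices stay
away from the future light cone, and by compactness a number of points depending only on $d$ pierces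
all the half-spaces (`exists_finite_piercing`). By pigeonhole, more than $k$ vertices have $\langle
y,v\rangle>0$ for a single $y$ in the light cone (`exists_deep_point`). The ball lies on the side
$\langle y,\cdot\rangle\le 0$.

Neighborliness now yields a $k$-face inside $\langle y,\cdot\rangle\ge 0$ and not inside $y^\perp$
(`exists_kFace_in_halfspace`). Its relative interior is strictly on the positive side, so it does
not cut the sphere. -/

/-! ### Finitely generated cones modulo a subspace, and their exposed rays. -/

section Cones

variable {V : Type*} [NormedAddCommGroup V] [NormedSpace ℝ V]

theorem exists_linearMap_neg_of_disjoint [FiniteDimensional ℝ V] (T : Finset V)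
    (U : Submodule ℝ V) (h : Disjoint (convexHull ℝ (T : Set V)) (U : Set V)) :
    ∃ f : V →ₗ[ℝ] ℝ, (∀ x ∈ U, f x = 0) ∧ ∀ t ∈ T, f t < 0 := by
  obtain ⟨f, a, b, hfa, hab, hfb⟩ := geometric_hahn_banach_compact_closed
    (convex_convexHull ℝ _) (T.finite_toSet.isCompact_convexHull (𝕜 := ℝ)) U.convex
    U.closed_of_finiteDimensional h
  -- A functional bounded below on a subspace vanishes on it.
  have hU : ∀ x ∈ U, f x = 0 := by
    intro x hx
    by_contra hne
    have := hfb (((b - 1) / f x) • x) (U.smul_mem _ hx)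
    rw [map_smul, smul_eq_mul, div_mul_cancel₀ _ hne] at this
    linarith
  refine ⟨f.toLinearMap, hU, fun t ht => ?_⟩
  have h0 := hfb 0 U.zero_mem
  rw [map_zero] at h0
  have := hfa t (subset_convexHull ℝ _ ht)
  simp only [ContinuousLinearMap.coe_coe]
  linarith

/-- `x` is, modulo the subspace `W`, a nonnegative combination of the vectors in `T`. -/
def IsNonnegCombModulo (W : Submodule ℝ V) (T : Finset V) (x : V) : Prop :=
  ∃ a : V → ℝ, (∀ t ∈ T, 0 ≤ a t) ∧ x - ∑ t ∈ T, a t • t ∈ W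

theorem PointedCone.exists_generators_of_fg {C : PointedCone ℝ V} (hC : C.FG) (W : Submodule ℝ V) :
    ∃ T : Finset V, (∀ t ∈ T, t ∈ C) ∧ ∀ x ∈ C, IsNonnegCombModulo W T x := by
  obtain ⟨T, rfl⟩ := hC
  refine ⟨T, fun t ht => Submodule.subset_span ht, fun x hx => ?_⟩
  obtain ⟨f, -, hf⟩ := Submodule.mem_span_finset.1 hx
  refine ⟨fun t => (f t : ℝ), fun t _ => (f t).2, ?_⟩
  have : ∑ t ∈ T, (f t : ℝ) • t = x := hf
  rw [this, sub_self]
  exact W.zero_mem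

/-- A generating set of least cardinality works: a generator that is redundant modulo `W` could be
substituted away. -/
theorem PointedCone.exists_minimal_generators_of_fg {C : PointedCone ℝ V} (hC : C.FG)
    (W : Submodule ℝ V) :
    ∃ T : Finset V, (∀ t ∈ T, t ∈ C) ∧ (∀ x ∈ C, IsNonnegCombModulo W T x) ∧
      ∀ r ∈ T, ∀ b : V → ℝ, (∀ t ∈ T, t ≠ r → 0 ≤ b t) →
        ∀ S : Finset V, (∀ t, t ∈ S ↔ t ∈ T ∧ t ≠ r) → r - ∑ t ∈ S, b t • t ∉ W := by
  classical
  obtain ⟨T, ⟨hTC, hT⟩, hmin⟩ := WellFounded.has_min (measure Finset.card).wf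
    {T : Finset V | (∀ t ∈ T, t ∈ C) ∧ ∀ x ∈ C, IsNonnegCombModulo W T x}
    (PointedCone.exists_generators_of_fg hC W)
  refine ⟨T, hTC, hT, fun r hr b hb S hS hmem => ?_⟩
  obtain rfl : S = T.erase r := by ext t; rw [hS, Finset.mem_erase, and_comm]
  refine hmin (T.erase r) ⟨fun t ht => hTC t (Finset.mem_of_mem_erase ht), fun x hx => ?_⟩
    (Finset.card_erase_lt_of_mem hr)
  obtain ⟨a, ha, hxa⟩ := hT x hx
  refine ⟨fun t => a t + a r * b t, fun t ht => ?_, ?_⟩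
  · have h1 := Finset.mem_erase.1 ht
    exact add_nonneg (ha t h1.2) (mul_nonneg (ha r hr) (hb t h1.2 h1.1))
  · have : x - ∑ t ∈ T.erase r, (a t + a r * b t) • t =
        (x - ∑ t ∈ T, a t • t) + a r • (r - ∑ t ∈ T.erase r, b t • t) := by
      rw [← Finset.add_sum_erase T _ hr]
      simp only [add_smul, Finset.sum_add_distrib, mul_smul, smul_sub, Finset.smul_sum]
      abel
    rw [this]
    exact W.add_mem hxa (W.smul_mem _ hmem)

theorem PointedCone.sum_smul_mem {C : PointedCone ℝ V} {T : Finset V} (hT : ∀ t ∈ T, t ∈ C)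
    {a : V → ℝ} (ha : ∀ t ∈ T, 0 ≤ a t) : ∑ t ∈ T, a t • t ∈ C :=
  Submodule.sum_mem _ fun t ht => C.smul_mem (ha t ht) (hT t ht)

/-- Generators of a finitely generated cone which is salient modulo `W`, each of which is
exposed. -/
theorem PointedCone.exists_exposed_generators_of_fg [FiniteDimensional ℝ V] {C : PointedCone ℝ V}
    (hC : C.FG) (W : Submodule ℝ V) (hsal : ∀ x ∈ C, ∀ y ∈ C, x + y ∈ W → x ∈ W) :
    ∃ T : Finset V, (∀ t ∈ T, t ∈ C ∧ t ∉ W) ∧ (∀ x ∈ C, IsNonnegCombModulo W T x) ∧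
      Disjoint (convexHull ℝ (T : Set V)) (W : Set V) ∧
      ∀ r ∈ T, ∃ f : V →ₗ[ℝ] ℝ, (∀ x ∈ W, f x = 0) ∧ f r = 0 ∧ (∀ x ∈ C, f x ≤ 0) ∧
        ∀ x ∈ C, f x = 0 → ∃ c : ℝ, 0 ≤ c ∧ x - c • r ∈ W := by
  classical
  obtain ⟨T, hTC, hT, hmin⟩ := PointedCone.exists_minimal_generators_of_fg hC W
  have hTW : ∀ t ∈ T, t ∉ W := fun t ht htW =>
    hmin t ht 0 (fun _ _ _ => le_rfl) (T.erase t)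
      (fun s => by rw [Finset.mem_erase, and_comm]) (by simpa using htW)
  have hdisj : ∀ S ⊆ T, Disjoint (convexHull ℝ (S : Set V)) (W : Set V) := by
    intro S hS
    rw [Set.disjoint_left]
    intro y hy hyW
    obtain ⟨b, hb, hb1, rfl⟩ := Finset.mem_convexHull'.1 hy
    obtain ⟨t, ht, hbt⟩ : ∃ t ∈ S, 0 < b t := by
      by_contra! hcon
      have := Finset.sum_nonpos hcon
      linarith
    have hyW' : b t • t + ∑ s ∈ S.erase t, b s • s ∈ W := by
      rw [Finset.add_sum_erase S (fun s => b s • s) ht]; exact hyW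
    have h1 := hsal _ (C.smul_mem hbt.le (hTC t (hS ht))) _
      (PointedCone.sum_smul_mem (fun s hs => hTC s (hS (Finset.mem_of_mem_erase hs)))
        (fun s hs => hb s (Finset.mem_of_mem_erase hs))) hyW'
    exact hTW t (hS ht) ((W.smul_mem_iff hbt.ne').1 h1)
  refine ⟨T, fun t ht => ⟨hTC t ht, hTW t ht⟩, hT, hdisj T subset_rfl, fun r hr => ?_⟩
  -- To expose the ray of `r`, separate the other generators from `W + ℝr`. A common point `w + c •
  -- r` contradicts salience modulo `W` if `c ≤ 0`, and makes `r` redundant if `c > 0`.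
  have hd : Disjoint (convexHull ℝ ((T.erase r : Finset V) : Set V))
      ((W ⊔ Submodule.span ℝ {r} : Submodule ℝ V) : Set V) := by
    rw [Set.disjoint_left]
    intro y hy hyW
    obtain ⟨w, hw, z, hz, hwz⟩ := Submodule.mem_sup.1 hyW
    obtain ⟨c, rfl⟩ := Submodule.mem_span_singleton.1 hz
    have hyC : y ∈ C := by
      obtain ⟨b, hb, -, rfl⟩ := Finset.mem_convexHull'.1 hy
      exact PointedCone.sum_smul_mem (fun s hs => hTC s (Finset.mem_of_mem_erase hs)) hb
    rcases le_or_gt c 0 with hc | hc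
    · have h1 : y + (-c) • r ∈ W := by
        rw [← hwz, neg_smul, add_neg_cancel_right]; exact hw
      have h2 := hsal y hyC _ (C.smul_mem (neg_nonneg.2 hc) (hTC r hr)) h1
      exact Set.disjoint_left.1 (hdisj _ (Finset.erase_subset r T)) hy h2
    · obtain ⟨b, hb, -, hby⟩ := Finset.mem_convexHull'.1 hy
      refine hmin r hr (fun t => c⁻¹ * b t) (fun t ht htr =>
        mul_nonneg (inv_nonneg.2 hc.le) (hb t (Finset.mem_erase.2 ⟨htr, ht⟩))) (T.erase r)
        (fun s => by rw [Finset.mem_erase, and_comm]) ?_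
      have : r - ∑ t ∈ T.erase r, (c⁻¹ * b t) • t = -(c⁻¹ • w) := by
        simp only [mul_smul]
        rw [← Finset.smul_sum, hby, ← hwz, smul_add, smul_smul, inv_mul_cancel₀ hc.ne', one_smul]
        abel
      rw [this]
      exact W.neg_mem (W.smul_mem _ hw)
  obtain ⟨f, hfU, hfT⟩ := exists_linearMap_neg_of_disjoint _ _ hd
  have hfW : ∀ x ∈ W, f x = 0 := fun x hx => hfU x (Submodule.mem_sup_left hx)
  have hfr : f r = 0 := hfU r (Submodule.mem_sup_right (Submodule.mem_span_singleton_self r))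
  have key : ∀ x, ∀ a : V → ℝ, x - ∑ t ∈ T, a t • t ∈ W →
      f x = ∑ t ∈ T.erase r, a t * f t := by
    intro x a hx
    have := hfW _ hx
    rw [map_sub, map_sum, sub_eq_zero, ← Finset.add_sum_erase T _ hr, map_smul, hfr, smul_zero,
      zero_add] at this
    simpa using this
  have hterm : ∀ a : V → ℝ, (∀ t ∈ T, 0 ≤ a t) → ∀ t ∈ T.erase r, a t * f t ≤ 0 :=
    fun a ha t ht => mul_nonpos_of_nonneg_of_nonpos (ha t (Finset.mem_of_mem_erase ht))
      (hfT t ht).le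
  refine ⟨f, hfW, hfr, fun x hx => ?_, fun x hx hfx => ?_⟩
  · obtain ⟨a, ha, hxa⟩ := hT x hx
    rw [key x a hxa]
    exact Finset.sum_nonpos (hterm a ha)
  · obtain ⟨a, ha, hxa⟩ := hT x hx
    rw [key x a hxa, Finset.sum_eq_zero_iff_of_nonpos (hterm a ha)] at hfx
    refine ⟨a r, ha r hr, ?_⟩
    have h0 : ∑ t ∈ T.erase r, a t • t = 0 := Finset.sum_eq_zero fun t ht => by
      rcases mul_eq_zero.1 (hfx t ht) with h | h
      · rw [h, zero_smul]
      · exact absurd h (hfT t ht).ne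
    rwa [← Finset.add_sum_erase T _ hr, h0, add_zero] at hxa

end Cones

/-! ### Faces, vertices and invariance under isomorphism of face lattices. -/

namespace SphericalPolytope

variable {d : ℕ} {P Q : SphericalPolytope d}

theorem eq_zero_of_add_eq_zero {x y : LorentzSpace d} (hx : x ∈ P.cone) (hy : y ∈ P.cone)
    (h : x + y = 0) : x = 0 := by
  by_contra hne
  refine P.salient x hx hne ?_
  rw [← eq_neg_of_add_eq_zero_right h]
  exact hy

theorem exists_exposed_generators (P : SphericalPolytope d) :
    ∃ T : Finset (LorentzSpace d), (∀ t ∈ T, t ∈ P.cone ∧ t ≠ 0) ∧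
      (∀ x ∈ P.cone, ∃ a : LorentzSpace d → ℝ, (∀ t ∈ T, 0 ≤ a t) ∧ x = ∑ t ∈ T, a t • t) ∧
      (∃ f : LorentzSpace d →ₗ[ℝ] ℝ, ∀ t ∈ T, f t < 0) ∧
      ∀ r ∈ T, ∃ f : LorentzSpace d →ₗ[ℝ] ℝ, f r = 0 ∧ (∀ x ∈ P.cone, f x ≤ 0) ∧
        ∀ x ∈ P.cone, f x = 0 → ∃ c : ℝ, 0 ≤ c ∧ x = c • r := by
  obtain ⟨T, hTC, hT, hdisj, hexp⟩ := PointedCone.exists_exposed_generators_of_fg P.polyhedral ⊥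
    (fun x hx y hy hxy => by
      rw [Submodule.mem_bot] at hxy ⊢
      exact eq_zero_of_add_eq_zero hx hy hxy)
  refine ⟨T, fun t ht => ⟨(hTC t ht).1, fun h => (hTC t ht).2 (by simp [h])⟩, fun x hx => ?_, ?_,
    fun r hr => ?_⟩
  · obtain ⟨a, ha, hxa⟩ := hT x hx
    exact ⟨a, ha, sub_eq_zero.1 ((Submodule.mem_bot ℝ).1 hxa)⟩
  · obtain ⟨f, -, hf⟩ := exists_linearMap_neg_of_disjoint T ⊥ hdisj
    exact ⟨f, hf⟩
  · obtain ⟨f, -, hfr, hfC, hf⟩ := hexp r hr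
    refine ⟨f, hfr, hfC, fun x hx hfx => ?_⟩
    obtain ⟨c, hc, hxc⟩ := hf x hx hfx
    exact ⟨c, hc, sub_eq_zero.1 ((Submodule.mem_bot ℝ).1 hxc)⟩

theorem IsFace.subset_cone {F : Set (LorentzSpace d)} (hF : P.IsFace F) : F ⊆ P.cone := by
  obtain ⟨ℓ, -, rfl⟩ := hF
  exact fun x hx => hx.1

theorem IsFace.zero_mem {F : Set (LorentzSpace d)} (hF : P.IsFace F) : 0 ∈ F := by
  obtain ⟨ℓ, -, rfl⟩ := hF
  exact ⟨P.cone.zero_mem, map_zero ℓ⟩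

theorem IsFace.smul_mem {F : Set (LorentzSpace d)} (hF : P.IsFace F) {x : LorentzSpace d}
    (hx : x ∈ F) {c : ℝ} (hc : 0 ≤ c) : c • x ∈ F := by
  obtain ⟨ℓ, -, rfl⟩ := hF
  exact ⟨P.cone.smul_mem hc hx.1, by rw [map_smul, hx.2, smul_zero]⟩

theorem IsFace.inter {F G : Set (LorentzSpace d)} (hF : P.IsFace F) (hG : P.IsFace G) :
    P.IsFace (F ∩ G) := by
  obtain ⟨ℓ, hℓ, rfl⟩ := hF
  obtain ⟨m, hm, rfl⟩ := hG
  refine ⟨ℓ + m, fun x hx => add_nonpos (hℓ x hx) (hm x hx), ?_⟩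
  ext x
  constructor
  · rintro ⟨⟨hx, h1⟩, -, h2⟩
    exact ⟨hx, by rw [LinearMap.add_apply, h1, h2, add_zero]⟩
  · rintro ⟨hx, h⟩
    rw [LinearMap.add_apply] at h
    have h1 := hℓ x hx
    have h2 := hm x hx
    exact ⟨⟨hx, by linarith⟩, hx, by linarith⟩

theorem isFace_zero (P : SphericalPolytope d) : P.IsFace {0} := by
  obtain ⟨T, hTC, hT, ⟨f, hf⟩, -⟩ := P.exists_exposed_generators
  have hterm : ∀ a : LorentzSpace d → ℝ, (∀ t ∈ T, 0 ≤ a t) → ∀ t ∈ T, a t * f t ≤ 0 :=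
    fun a ha t ht => mul_nonpos_of_nonneg_of_nonpos (ha t ht) (hf t ht).le
  refine ⟨f, fun x hx => ?_, ?_⟩
  · obtain ⟨a, ha, rfl⟩ := hT x hx
    rw [map_sum]
    simpa using Finset.sum_nonpos (hterm a ha)
  · ext x
    constructor
    · rintro rfl
      exact ⟨P.cone.zero_mem, map_zero f⟩
    · rintro ⟨hx, hfx⟩
      obtain ⟨a, ha, rfl⟩ := hT x hx
      simp only [map_sum, map_smul, smul_eq_mul] at hfx
      rw [Finset.sum_eq_zero_iff_of_nonpos (hterm a ha)] at hfx
      refine Finset.sum_eq_zero fun t ht => ?_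
      rcases mul_eq_zero.1 (hfx t ht) with h | h
      · rw [h, zero_smul]
      · exact absurd h (hf t ht).ne

theorem normalize_mem_vertices {r : LorentzSpace d} (hr : r ∈ P.cone) (hr0 : r ≠ 0)
    {f : LorentzSpace d →ₗ[ℝ] ℝ} (hfr : f r = 0) (hf : ∀ x ∈ P.cone, f x ≤ 0)
    (hfx : ∀ x ∈ P.cone, f x = 0 → ∃ c : ℝ, 0 ≤ c ∧ x = c • r) :
    ‖r‖⁻¹ • r ∈ P.vertices := by
  refine ⟨by simp [norm_smul, hr0], {x | x ∈ P.cone ∧ f x = 0}, ⟨⟨f, hf, rfl⟩, ?_⟩,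
    P.cone.smul_mem (inv_nonneg.2 (norm_nonneg r)) hr, by rw [map_smul, hfr, smul_zero]⟩
  have : Submodule.span ℝ {x | x ∈ P.cone ∧ f x = 0} = Submodule.span ℝ {r} := by
    apply le_antisymm
    · rw [Submodule.span_le]
      rintro x ⟨hx, hx0⟩
      obtain ⟨c, -, rfl⟩ := hfx x hx hx0
      exact Submodule.smul_mem _ _ (Submodule.mem_span_singleton_self r)
    · exact Submodule.span_mono (Set.singleton_subset_iff.2 ⟨hr, hfr⟩)
  rw [this, finrank_span_singleton hr0]

theorem norm_of_mem_vertices {v : LorentzSpace d} (hv : v ∈ P.vertices) : ‖v‖ = 1 := by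
  simpa using hv.1

theorem ne_zero_of_mem_vertices {v : LorentzSpace d} (hv : v ∈ P.vertices) : v ≠ 0 := by
  rintro rfl
  simpa using norm_of_mem_vertices hv

theorem mem_cone_of_mem_vertices {v : LorentzSpace d} (hv : v ∈ P.vertices) : v ∈ P.cone := by
  obtain ⟨-, F, hF, hvF⟩ := hv
  exact hF.1.subset_cone hvF

/-- A face is generated by the vertices that it contains. -/
theorem IsFace.subset_hull {F : Set (LorentzSpace d)} (hF : P.IsFace F) :
    F ⊆ PointedCone.hull ℝ (F ∩ P.vertices) := by
  intro x hx
  obtain ⟨T, hTC, hT, -, hexp⟩ := P.exists_exposed_generators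
  have hxC := hF.subset_cone hx
  obtain ⟨a, ha, rfl⟩ := hT x hxC
  have hmem : ∀ t ∈ T, a t • t ∈ F := by
    obtain ⟨ℓ, hℓ, rfl⟩ := hF
    have h0 := hx.2
    have hC : ∀ t ∈ T, a t • t ∈ P.cone := fun t ht => P.cone.smul_mem (ha t ht) (hTC t ht).1
    rw [map_sum, Finset.sum_eq_zero_iff_of_nonpos (fun t ht => hℓ _ (hC t ht))] at h0
    exact fun t ht => ⟨hC t ht, h0 t ht⟩
  refine Submodule.sum_mem _ fun t ht => ?_
  rcases (ha t ht).eq_or_lt with h | h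
  · rw [← h, zero_smul]
    exact Submodule.zero_mem _
  · have ht0 := (hTC t ht).2
    obtain ⟨f, hfr, hfC, hf⟩ := hexp t ht
    have hv := normalize_mem_vertices (hTC t ht).1 ht0 hfr hfC hf
    have hvF : ‖t‖⁻¹ • t ∈ F := by
      have := hF.smul_mem (hmem t ht) (c := ‖t‖⁻¹ * (a t)⁻¹) (by positivity)
      rwa [smul_smul, mul_assoc, inv_mul_cancel₀ h.ne', mul_one] at this
    have := (PointedCone.hull ℝ (F ∩ P.vertices)).smul_mem (mul_nonneg h.le (norm_nonneg t))
      (PointedCone.subset_hull ⟨hvF, hv⟩)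
    rwa [smul_smul, mul_assoc, mul_inv_cancel₀ (norm_ne_zero_iff.2 ht0), mul_one] at this

theorem IsFace.exists_vertex_mem {F : Set (LorentzSpace d)} (hF : P.IsFace F)
    {x : LorentzSpace d} (hx : x ∈ F) (hx0 : x ≠ 0) : ∃ v ∈ P.vertices, v ∈ F := by
  by_contra! hcon
  have h : F ∩ P.vertices = ∅ := by
    ext v
    simp only [Set.mem_inter_iff, Set.mem_empty_iff_false, iff_false, not_and]
    exact fun h1 h2 => hcon v h2 h1
  have := hF.subset_hull hx
  rw [h] at this
  exact hx0 (by simpa [PointedCone.hull] using this)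

theorem IsFace.span_eq {F : Set (LorentzSpace d)} (hF : P.IsFace F) :
    Submodule.span ℝ F = Submodule.span ℝ (F ∩ P.vertices) :=
  le_antisymm (Submodule.span_le.2 fun _ hx => PointedCone.hull_le_span ℝ _ (hF.subset_hull hx))
    (Submodule.span_mono Set.inter_subset_left)

/-- The ray spanned by `v`. -/
def ray (v : LorentzSpace d) : Set (LorentzSpace d) := {x | ∃ c : ℝ, 0 ≤ c ∧ x = c • v}

theorem mem_ray_self (v : LorentzSpace d) : v ∈ ray v := ⟨1, zero_le_one, (one_smul ℝ v).symm⟩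

theorem isFace_ray {v : LorentzSpace d} (hv : v ∈ P.vertices) : P.IsFace (ray v) := by
  have hv0 := ne_zero_of_mem_vertices hv
  have hvC := mem_cone_of_mem_vertices hv
  obtain ⟨-, F, ⟨hF, hrank⟩, hvF⟩ := hv
  suffices F = ray v by rwa [← this]
  have hspan : Submodule.span ℝ {v} = Submodule.span ℝ F := by
    apply Submodule.eq_of_le_of_finrank_eq
    · exact Submodule.span_mono (Set.singleton_subset_iff.2 hvF)
    · rw [hrank, finrank_span_singleton hv0]
  ext x
  constructor
  · intro hx
    have hx' : x ∈ Submodule.span ℝ {v} := hspan ▸ Submodule.subset_span hx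
    obtain ⟨c, rfl⟩ := Submodule.mem_span_singleton.1 hx'
    refine ⟨c, ?_, rfl⟩
    by_contra! hc
    have h1 : (-c) • v = 0 := eq_zero_of_add_eq_zero (P.cone.smul_mem (by linarith) hvC)
      (hF.subset_cone hx) (by rw [← add_smul]; simp)
    rcases smul_eq_zero.1 h1 with h | h
    · linarith
    · exact hv0 h
  · rintro ⟨c, hc, rfl⟩
    exact hF.smul_mem hvF hc

theorem IsFace.ray_subset_iff {F : Set (LorentzSpace d)} (hF : P.IsFace F)
    {v : LorentzSpace d} : ray v ⊆ F ↔ v ∈ F :=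
  ⟨fun h => h (mem_ray_self v), fun h => by rintro x ⟨c, hc, rfl⟩; exact hF.smul_mem h hc⟩

theorem eq_of_mem_ray {v w : LorentzSpace d} (hv : v ∈ P.vertices) (hw : w ∈ P.vertices)
    (h : v ∈ ray w) : v = w := by
  obtain ⟨c, hc, rfl⟩ := h
  have := norm_of_mem_vertices hv
  rw [norm_smul, norm_of_mem_vertices hw, mul_one, Real.norm_of_nonneg hc] at this
  rw [this, one_smul]

theorem IsFace.subset_ray {F : Set (LorentzSpace d)} (hF : P.IsFace F) {v x : LorentzSpace d}
    (hFv : F ⊆ ray v) (hx : x ∈ F) (hx0 : x ≠ 0) : F = ray v := by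
  refine hFv.antisymm (hF.ray_subset_iff.2 ?_)
  obtain ⟨c, hc, rfl⟩ := hFv hx
  have hc0 : c ≠ 0 := by rintro rfl; simp at hx0
  have := hF.smul_mem hx (inv_nonneg.2 hc)
  rwa [smul_smul, inv_mul_cancel₀ hc0, one_smul] at this

theorem orderIso_zero (e : P.FaceLattice ≃o Q.FaceLattice) :
    (e ⟨{0}, P.isFace_zero⟩).1 = {0} := by
  refine Set.Subset.antisymm ?_ (Set.singleton_subset_iff.2 (e _).2.zero_mem)
  have h : (⟨{0}, P.isFace_zero⟩ : P.FaceLattice) ≤ e.symm ⟨{0}, Q.isFace_zero⟩ :=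
    Set.singleton_subset_iff.2 (e.symm _).2.zero_mem
  exact e.le_symm_apply.1 h

/-- The rays of vertices are the atoms of the face lattice: every nonzero face contains one, and a
nonzero face inside a ray is the whole ray. Hence an isomorphism permutes them. -/
theorem orderIso_ray (e : P.FaceLattice ≃o Q.FaceLattice) {v : LorentzSpace d}
    (hv : v ∈ P.vertices) : ∃ w ∈ Q.vertices, (e ⟨ray v, isFace_ray hv⟩).1 = ray w := by
  set A : P.FaceLattice := ⟨ray v, isFace_ray hv⟩ with hA
  obtain ⟨x, hx, hx0⟩ : ∃ x ∈ (e A).1, x ≠ 0 := by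
    by_contra! hcon
    have h1 : e A ≤ e ⟨{0}, P.isFace_zero⟩ := fun x hx => by
      rw [hcon x hx]
      exact (e _).2.zero_mem
    have h2 : v ∈ ({0} : Set (LorentzSpace d)) := e.le_iff_le.1 h1 (mem_ray_self v)
    exact ne_zero_of_mem_vertices hv h2
  obtain ⟨w, hw, hwA⟩ := (e A).2.exists_vertex_mem hx hx0
  refine ⟨w, hw, ?_⟩
  set B : Q.FaceLattice := ⟨ray w, isFace_ray hw⟩
  have hBA : e.symm B ≤ A := e.symm_apply_le.2 ((e A).2.ray_subset_iff.2 hwA)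
  have hB0 : ∃ y ∈ (e.symm B).1, y ≠ 0 := by
    by_contra! hcon
    have h1 : e.symm B ≤ ⟨{0}, P.isFace_zero⟩ := fun y hy => hcon y hy
    have h2 := e.symm_apply_le.1 h1 (mem_ray_self w)
    rw [orderIso_zero] at h2
    exact ne_zero_of_mem_vertices hw h2
  obtain ⟨y, hy, hy0⟩ := hB0
  have h3 : e.symm B = A := Subtype.ext ((e.symm B).2.subset_ray hBA hy hy0)
  rw [← h3, e.apply_symm_apply]

/-- Neighborliness and the number of vertices only depend on the combinatorial type. -/
theorem CombEquiv.isNeighborly_and_ncard (h : P.CombEquiv Q) {k : ℕ} (hP : P.IsNeighborly k) :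
    Q.IsNeighborly k ∧ Q.vertices.ncard = P.vertices.ncard := by
  classical
  obtain ⟨e⟩ := h
  choose! f hfV hf using fun (w : LorentzSpace d) (hw : w ∈ Q.vertices) => orderIso_ray e.symm hw
  have hinj : ∀ w ∈ Q.vertices, ∀ w' ∈ Q.vertices, f w = f w' → w = w' := by
    intro w hw w' hw' hww
    have h1 : e.symm ⟨ray w, isFace_ray hw⟩ = e.symm ⟨ray w', isFace_ray hw'⟩ :=
      Subtype.ext (by rw [hf w hw, hf w' hw', hww])
    have h2 : ray w = ray w' := congrArg Subtype.val (e.symm.injective h1)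
    exact eq_of_mem_ray hw hw' (h2 ▸ mem_ray_self w)
  have hsurj : ∀ v ∈ P.vertices, ∃ w ∈ Q.vertices, f w = v := by
    intro v hv
    obtain ⟨w, hw, hvw⟩ := orderIso_ray e hv
    refine ⟨w, hw, ?_⟩
    have h1 : e ⟨ray v, isFace_ray hv⟩ = ⟨ray w, isFace_ray hw⟩ := Subtype.ext hvw
    have h2 := hf w hw
    rw [← h1, e.symm_apply_apply] at h2
    exact eq_of_mem_ray (hfV w hw) hv (show f w ∈ ray v by
      rw [show ray v = ray (f w) from h2]; exact mem_ray_self _)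
  have hmem : ∀ (F : P.FaceLattice) (w : LorentzSpace d), w ∈ Q.vertices →
      (w ∈ (e F).1 ↔ f w ∈ F.1) := by
    intro F w hw
    rw [← (e F).2.ray_subset_iff, ← F.2.ray_subset_iff, ← hf w hw]
    exact (e.symm_apply_le (x := F) (y := ⟨ray w, isFace_ray hw⟩)).symm
  constructor
  · intro I hI hIk
    have hinjI : Set.InjOn f I := fun w hw w' hw' => hinj w (hI hw) w' (hI hw')
    obtain ⟨F, hF, hFI⟩ := hP (I.image f)
      (by
        intro v hv
        obtain ⟨w, hw, rfl⟩ := Finset.mem_image.1 (Finset.mem_coe.1 hv)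
        exact hfV w (hI hw))
      (by rw [Finset.card_image_of_injOn hinjI, hIk])
    refine ⟨(e ⟨F, hF⟩).1, (e ⟨F, hF⟩).2, ?_⟩
    ext w
    constructor
    · rintro ⟨hwF, hw⟩
      have h1 : f w ∈ F ∩ P.vertices := ⟨(hmem ⟨F, hF⟩ w hw).1 hwF, hfV w hw⟩
      rw [hFI] at h1
      obtain ⟨w', hw', hww⟩ := Finset.mem_image.1 (Finset.mem_coe.1 h1)
      rwa [← hinj w' (hI hw') w hw hww]
    · intro hwI
      have h1 : f w ∈ F ∩ P.vertices := by
        rw [hFI]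
        exact Finset.mem_coe.2 (Finset.mem_image_of_mem f hwI)
      exact ⟨(hmem ⟨F, hF⟩ w (hI hwI)).2 h1.1, hI hwI⟩
  · exact Set.ncard_congr (fun w _ => f w) (fun w hw => hfV w hw)
      (fun w w' hw hw' => hinj w hw w' hw')
      (fun v hv => by obtain ⟨w, hw, h⟩ := hsurj v hv; exact ⟨w, hw, h⟩)

end SphericalPolytope

/-! ### Faces of neighborly polytopes inside a half-space. -/

namespace SphericalPolytope

variable {d : ℕ} {P : SphericalPolytope d} {k : ℕ}

/-- Complete `I` to `k` vertices in two ways, with disjoint additions, and intersect the two faces.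
The bound `2 * k` leaves room for both completions. -/
theorem IsNeighborly.exists_face_of_card_le (hP : P.IsNeighborly k) (hk : 0 < k)
    (hn : 2 * k ≤ P.vertices.ncard) (I : Finset (LorentzSpace d))
    (hI : (I : Set (LorentzSpace d)) ⊆ P.vertices) (hIk : I.card ≤ k) :
    ∃ F, P.IsFace F ∧ F ∩ P.vertices = (I : Set (LorentzSpace d)) := by
  classical
  have hfin : P.vertices.Finite := Set.finite_of_ncard_pos (by omega)
  obtain ⟨V, hV⟩ := hfin.exists_finset_coe
  rw [← hV, Set.ncard_coe_finset] at hn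
  have hIV : I ⊆ V := by rw [← Finset.coe_subset, hV]; exact hI
  have h1 := Finset.card_sdiff_add_card_eq_card hIV
  obtain ⟨A, hA, hAk⟩ := Finset.exists_subset_card_eq (s := V \ I) (n := k - I.card) (by omega)
  have h2 := Finset.card_sdiff_add_card_eq_card hA
  obtain ⟨B, hB, hBk⟩ := Finset.exists_subset_card_eq (s := (V \ I) \ A) (n := k - I.card)
    (by omega)
  have hBI : B ⊆ V \ I := hB.trans Finset.sdiff_subset
  have hface : ∀ A ⊆ V \ I, A.card = k - I.card → ∃ F, P.IsFace F ∧
      F ∩ P.vertices = ((I ∪ A : Finset (LorentzSpace d)) : Set (LorentzSpace d)) := by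
    intro A hA hAk
    refine hP _ ?_ ?_
    · rw [← hV, Finset.coe_subset]
      exact Finset.union_subset hIV (hA.trans Finset.sdiff_subset)
    · rw [Finset.card_union_of_disjoint (Finset.disjoint_sdiff.mono_right hA)]
      omega
  obtain ⟨F, hF, hFA⟩ := hface A hA hAk
  obtain ⟨G, hG, hGB⟩ := hface B hBI hBk
  refine ⟨F ∩ G, hF.inter hG, ?_⟩
  rw [Set.inter_inter_distrib_right, hFA, hGB]
  ext x
  simp only [Finset.coe_union, Set.mem_inter_iff, Set.mem_union, Finset.mem_coe]
  constructor
  · rintro ⟨h | h, h' | h'⟩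
    · exact h
    · exact h
    · exact h'
    · exact absurd h (Finset.mem_sdiff.1 (hB h')).2
  · exact fun h => ⟨Or.inl h, Or.inl h⟩

theorem exists_functional_of_face {F : Set (LorentzSpace d)} (hF : P.IsFace F)
    {I : Finset (LorentzSpace d)} (hFI : F ∩ P.vertices = (I : Set (LorentzSpace d))) :
    ∃ a : LorentzSpace d →ₗ[ℝ] ℝ, (∀ x ∈ P.cone, 0 ≤ a x) ∧ (∀ v ∈ I, a v = 0) ∧
      ∀ v ∈ P.vertices, v ∉ I → 0 < a v := by
  obtain ⟨ℓ, hℓ, rfl⟩ := hF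
  refine ⟨-ℓ, fun x hx => neg_nonneg.2 (hℓ x hx), fun v hv => ?_, fun v hv hvI => ?_⟩
  · have h : v ∈ (I : Set (LorentzSpace d)) := hv
    rw [← hFI] at h
    simp [h.1.2]
  · have hvC := mem_cone_of_mem_vertices hv
    refine neg_pos.2 ((hℓ v hvC).lt_of_ne fun h0 => hvI ?_)
    rw [← Finset.mem_coe, ← hFI]
    exact ⟨⟨hvC, h0⟩, hv⟩

/-- The vertices in `I` are linearly independent: for each `v ∈ I`, the face on `I \ {v}` gives a
functional that vanishes on the others and is positive at `v`. -/
theorem finrank_span_face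
    (hface : ∀ I : Finset (LorentzSpace d), (I : Set (LorentzSpace d)) ⊆ P.vertices →
      I.card ≤ k → ∃ F, P.IsFace F ∧ F ∩ P.vertices = (I : Set (LorentzSpace d)))
    {I : Finset (LorentzSpace d)} (hI : (I : Set (LorentzSpace d)) ⊆ P.vertices)
    (hIk : I.card ≤ k) {F : Set (LorentzSpace d)} (hF : P.IsFace F)
    (hFI : F ∩ P.vertices = (I : Set (LorentzSpace d))) :
    Module.finrank ℝ (Submodule.span ℝ F) = I.card := by
  classical
  rw [hF.span_eq, hFI]
  apply finrank_span_finset_eq_card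
  rw [linearIndepOn_finset_iff]
  intro g hg v hv
  obtain ⟨G, hG, hGI⟩ := hface (I.erase v)
    ((Finset.coe_subset.2 (Finset.erase_subset v I)).trans hI)
    ((Finset.card_le_card (Finset.erase_subset v I)).trans hIk)
  obtain ⟨a, -, ha0, ha⟩ := exists_functional_of_face hG hGI
  have h := congrArg a hg
  rw [map_zero, map_sum, ← Finset.add_sum_erase I _ hv, Finset.sum_eq_zero, add_zero] at h
  · simp only [id, map_smul, smul_eq_mul] at h
    exact (mul_eq_zero.1 h).resolve_right (ha v (hI hv) (Finset.notMem_erase v I)).ne'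
  · intro w hw
    simp [ha0 w hw]

/-- A face with a vector outside of it at which `h` is nonnegative, where `h` vanishes on the face,
is contained in a face of one dimension more on which `h` is nonnegative. -/
theorem exists_face_extending {G : Set (LorentzSpace d)} (hG : P.IsFace G)
    {h : LorentzSpace d →ₗ[ℝ] ℝ} (hhG : ∀ x ∈ G, h x = 0) {u : LorentzSpace d}
    (hu : u ∈ P.cone) (huG : u ∉ G) (hhu : 0 ≤ h u) :
    ∃ F, P.IsFace F ∧ G ⊆ F ∧ (∀ x ∈ F, 0 ≤ h x) ∧
      Module.finrank ℝ (Submodule.span ℝ F) = Module.finrank ℝ (Submodule.span ℝ G) + 1 := by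
  have hGC := hG.subset_cone
  obtain ⟨m, hm, hGm⟩ := hG
  set W := Submodule.span ℝ G with hW
  have hmW : ∀ x ∈ W, m x = 0 := by
    have : W ≤ LinearMap.ker m := Submodule.span_le.2 fun x hx => by
      rw [hGm] at hx
      exact hx.2
    exact fun x hx => this hx
  have hhW : ∀ x ∈ W, h x = 0 := by
    have : W ≤ LinearMap.ker h := Submodule.span_le.2 hhG
    exact fun x hx => this hx
  have hCW : ∀ x ∈ P.cone, m x = 0 → x ∈ G := fun x hx hx0 => by rw [hGm]; exact ⟨hx, hx0⟩
  obtain ⟨T, hTC, hT, -, hexp⟩ := PointedCone.exists_exposed_generators_of_fg P.polyhedral W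
    (fun x hx y hy hxy => by
      have h1 := hmW _ hxy
      rw [map_add] at h1
      have h2 := hm x hx
      have h3 := hm y hy
      exact Submodule.subset_span (hCW x hx (by linarith)))
  -- Modulo `W` the cone is salient, and `h` descends to the quotient. If `h` were negative on all
  -- generators, `h u ≥ 0` would force `u ∈ W`, hence `u ∈ G`. The exposed ray of `r` in the
  -- quotient is the new face.
  obtain ⟨r, hr, hhr⟩ : ∃ r ∈ T, 0 ≤ h r := by
    by_contra! hcon
    obtain ⟨a, ha, hua⟩ := hT u hu
    have hterm : ∀ t ∈ T, a t * h t ≤ 0 := fun t ht =>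
      mul_nonpos_of_nonneg_of_nonpos (ha t ht) (hcon t ht).le
    have h1 := hhW _ hua
    rw [map_sub, map_sum, sub_eq_zero] at h1
    simp only [map_smul, smul_eq_mul] at h1
    have h2 := (Finset.sum_eq_zero_iff_of_nonpos hterm).1
      (le_antisymm (Finset.sum_nonpos hterm) (h1 ▸ hhu))
    have h3 : ∑ t ∈ T, a t • t = 0 := Finset.sum_eq_zero fun t ht => by
      rcases mul_eq_zero.1 (h2 t ht) with h | h
      · rw [h, zero_smul]
      · exact absurd h (hcon t ht).ne
    rw [h3, sub_zero] at hua
    exact huG (hCW u hu (hmW u hua))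
  obtain ⟨f, hfW, hfr, hfC, hf⟩ := hexp r hr
  have hGF : G ⊆ {x | x ∈ P.cone ∧ f x = 0} := fun x hx =>
    ⟨hGC hx, hfW x (Submodule.subset_span hx)⟩
  refine ⟨{x | x ∈ P.cone ∧ f x = 0}, ⟨f, hfC, rfl⟩, hGF, ?_, ?_⟩
  · rintro x ⟨hx, hx0⟩
    obtain ⟨c, hc, hxc⟩ := hf x hx hx0
    have := hhW _ hxc
    rw [map_sub, map_smul, sub_eq_zero] at this
    rw [this]
    exact mul_nonneg hc hhr
  · rw [← Submodule.finrank_sup_span_singleton (hTC r hr).2]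
    suffices hspan : Submodule.span ℝ {x | x ∈ P.cone ∧ f x = 0} = W ⊔ Submodule.span ℝ {r} by
      rw [hspan]
    apply le_antisymm
    · rw [Submodule.span_le]
      rintro x ⟨hx, hx0⟩
      obtain ⟨c, hc, hxc⟩ := hf x hx hx0
      exact Submodule.mem_sup.2 ⟨_, hxc, c • r,
        Submodule.smul_mem _ _ (Submodule.mem_span_singleton_self r), by abel⟩
    · refine sup_le (Submodule.span_mono hGF) ?_
      exact Submodule.span_mono (Set.singleton_subset_iff.2 ⟨(hTC r hr).1, hfr⟩)

/-- The hyperplane is tilted onto one more vertex of `M` at a time. Only multiples of functionals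
nonnegative on the cone are subtracted, so `h ≤ ℓ` persists there, and a face in `h ≥ 0` also lies
in `ℓ ≥ 0`. -/
theorem exists_functional_vanishing_on_subset
    (hface : ∀ I : Finset (LorentzSpace d), (I : Set (LorentzSpace d)) ⊆ P.vertices →
      I.card ≤ k → ∃ F, P.IsFace F ∧ F ∩ P.vertices = (I : Set (LorentzSpace d)))
    {ℓ : LorentzSpace d →ₗ[ℝ] ℝ} {M : Finset (LorentzSpace d)}
    (hM : (M : Set (LorentzSpace d)) ⊆ P.vertices) (hMk : k < M.card)
    (hℓ : ∀ v ∈ M, 0 ≤ ℓ v) (i : ℕ) (hi : i ≤ k) :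
    ∃ W ⊆ M, W.card = i ∧ ∃ h : LorentzSpace d →ₗ[ℝ] ℝ,
      (∀ v ∈ M, 0 ≤ h v) ∧ (∀ v ∈ W, h v = 0) ∧ ∀ x ∈ P.cone, h x ≤ ℓ x := by
  classical
  induction i with
  | zero => exact ⟨∅, Finset.empty_subset _, rfl, ℓ, hℓ, by simp, fun _ _ => le_rfl⟩
  | succ i ih =>
    obtain ⟨W, hWM, hWi, h, hhM, hhW, hhℓ⟩ := ih (by omega)
    obtain ⟨F, hF, hFW⟩ := hface W ((Finset.coe_subset.2 hWM).trans hM) (by omega)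
    obtain ⟨a, haC, haW, ha⟩ := exists_functional_of_face hF hFW
    have hne : (M \ W).Nonempty := by
      rw [← Finset.card_pos]
      have := Finset.card_sdiff_add_card_eq_card hWM
      omega
    -- The least ratio `h v / a v` is the largest multiple of `a` that can be subtracted with `h`
    -- still nonnegative on `M`; it is attained at the new zero `w`.
    obtain ⟨w, hw, hwmin⟩ := Finset.exists_min_image (M \ W) (fun v => h v / a v) hne
    obtain ⟨hwM, hwW⟩ := Finset.mem_sdiff.1 hw
    have haw := ha w (hM hwM) hwW
    have ht : 0 ≤ h w / a w := div_nonneg (hhM w hwM) haw.le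
    refine ⟨insert w W, Finset.insert_subset hwM hWM, by
      rw [Finset.card_insert_of_notMem hwW, hWi], h - (h w / a w) • a, ?_, ?_, ?_⟩
    · intro v hv
      rw [LinearMap.sub_apply, LinearMap.smul_apply, smul_eq_mul, sub_nonneg]
      by_cases hvW : v ∈ W
      · rw [haW v hvW, mul_zero]
        exact hhM v hv
      · exact (le_div_iff₀ (ha v (hM hv) hvW)).1 (hwmin v (Finset.mem_sdiff.2 ⟨hv, hvW⟩))
    · intro v hv
      rw [LinearMap.sub_apply, LinearMap.smul_apply, smul_eq_mul]
      rcases Finset.mem_insert.1 hv with rfl | hvW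
      · rw [div_mul_cancel₀ _ haw.ne', sub_self]
      · rw [haW v hvW, hhW v hvW, mul_zero, sub_zero]
    · intro x hx
      rw [LinearMap.sub_apply, LinearMap.smul_apply, smul_eq_mul]
      have := mul_nonneg ht (haC x hx)
      have := hhℓ x hx
      linarith

/-- In a neighborly polytope, a half-space with more than `k` vertices in its interior contains a
`k`-face. -/
theorem exists_kFace_in_halfspace
    (hface : ∀ I : Finset (LorentzSpace d), (I : Set (LorentzSpace d)) ⊆ P.vertices →
      I.card ≤ k → ∃ F, P.IsFace F ∧ F ∩ P.vertices = (I : Set (LorentzSpace d)))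
    (hk : 0 < k) {ℓ : LorentzSpace d →ₗ[ℝ] ℝ} {M : Finset (LorentzSpace d)}
    (hM : (M : Set (LorentzSpace d)) ⊆ P.vertices) (hMk : k < M.card)
    (hℓ : ∀ v ∈ M, 0 < ℓ v) :
    ∃ F, P.IsKFace k F ∧ (∀ x ∈ F, 0 ≤ ℓ x) ∧ ∃ x ∈ F, 0 < ℓ x := by
  classical
  obtain ⟨W, hWM, hWk, h, hhM, hhW, hhℓ⟩ := exists_functional_vanishing_on_subset hface hM hMk
    (fun v hv => (hℓ v hv).le) k le_rfl
  have hWV := (Finset.coe_subset.2 hWM).trans hM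
  obtain ⟨G, hG, hGW⟩ := hface W hWV hWk.le
  obtain ⟨u, huM, huW⟩ := Finset.exists_mem_notMem_of_card_lt_card (hWk.trans_lt hMk)
  have huG : u ∉ G := fun huG => huW (by rw [← Finset.mem_coe, ← hGW]; exact ⟨huG, hM huM⟩)
  have hhG : ∀ x ∈ G, h x = 0 := by
    have : Submodule.span ℝ G ≤ LinearMap.ker h := by
      rw [hG.span_eq, hGW, Submodule.span_le]
      exact hhW
    exact fun x hx => this (Submodule.subset_span hx)
  obtain ⟨F, hF, hGF, hhF, hrank⟩ := exists_face_extending hG hhG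
    (mem_cone_of_mem_vertices (hM huM)) huG (hhM u huM)
  obtain ⟨w, hw⟩ : W.Nonempty := by rw [← Finset.card_pos]; omega
  have hwG : w ∈ G ∩ P.vertices := by rw [hGW]; exact hw
  refine ⟨F, ⟨hF, ?_⟩, fun x hx => (hhF x hx).trans (hhℓ x (hF.subset_cone hx)),
    w, hGF hwG.1, hℓ w (hWM hw)⟩
  rw [hrank, finrank_span_face hface hWV hWk.le hG hGW, hWk]

theorem exists_prolongation_of_mem_intrinsicInterior {E : Type*} [NormedAddCommGroup E]
    [NormedSpace ℝ E] {F : Set E} {x z : E} (hx : x ∈ intrinsicInterior ℝ F) (hz : z ∈ F) :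
    ∃ ε : ℝ, 0 < ε ∧ x + ε • (x - z) ∈ F := by
  obtain ⟨y, hy, rfl⟩ := mem_intrinsicInterior.1 hx
  have hzA : z ∈ affineSpan ℝ F := subset_affineSpan ℝ F hz
  have hline : ∀ ε : ℝ, (y : E) + ε • ((y : E) - z) ∈ affineSpan ℝ F := by
    intro ε
    have := AffineMap.lineMap_mem (1 + ε) hzA y.2
    rw [AffineMap.lineMap_apply] at this
    convert this using 1
    simp only [vsub_eq_sub, vadd_eq_add, add_smul, one_smul]
    abel
  let g : ℝ → affineSpan ℝ F := fun ε => ⟨(y : E) + ε • ((y : E) - z), hline ε⟩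
  have hg : Continuous g := by
    refine Continuous.subtype_mk ?_ _
    fun_prop
  have hg0 : g 0 = y := Subtype.ext (by simp [g])
  have hev : ∀ᶠ ε in nhds (0 : ℝ), g ε ∈ interior ((↑) ⁻¹' F : Set (affineSpan ℝ F)) :=
    hg.continuousAt.eventually (by rw [hg0]; exact isOpen_interior.mem_nhds hy)
  obtain ⟨ε, hε, h⟩ := ((hev.filter_mono (nhdsWithin_le_nhds (s := Set.Ioi 0))).and
    self_mem_nhdsWithin).exists
  exact ⟨ε, h, interior_subset (s := ((↑) ⁻¹' F : Set (affineSpan ℝ F))) hε⟩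

/-- From a point `z` with `ℓ z > 0`, the segment to a relative interior point `x` can be prolonged
within `F`. If `ℓ x ≤ 0`, then `ℓ` would be negative beyond `x`. -/
theorem not_stronglyCuts_of_nonneg {F : Set (LorentzSpace d)} {ℓ : LorentzSpace d →ₗ[ℝ] ℝ}
    (hF : ∀ x ∈ F, 0 ≤ ℓ x) (hpos : ∃ x ∈ F, 0 < ℓ x) (hB : ∀ x ∈ ballB d, ℓ x ≤ 0) :
    ¬ StronglyCuts F := by
  rintro ⟨x, hx, hxB⟩
  obtain ⟨z, hz, hℓz⟩ := hpos
  obtain ⟨ε, hε, h⟩ := exists_prolongation_of_mem_intrinsicInterior hx hz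
  have h1 := hF _ h
  have h2 := hB x hxB
  rw [map_add, map_smul, map_sub, smul_eq_mul] at h1
  nlinarith [mul_pos hε hℓz]

end SphericalPolytope

/-! ### Lorentzian geometry and piercing of hyperbolic half-spaces. -/

section Lorentz

variable {d : ℕ}

theorem lorentzProd_comm (x y : LorentzSpace d) : lorentzProd x y = lorentzProd y x := by
  simp only [lorentzProd, mul_comm]

theorem lorentzProd_add_right (x y z : LorentzSpace d) :
    lorentzProd x (y + z) = lorentzProd x y + lorentzProd x z := by
  simp only [lorentzProd, PiLp.add_apply, mul_add, Finset.sum_add_distrib]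
  ring

theorem lorentzProd_smul_right (c : ℝ) (x y : LorentzSpace d) :
    lorentzProd x (c • y) = c * lorentzProd x y := by
  simp only [lorentzProd, PiLp.smul_apply, smul_eq_mul, mul_add, Finset.mul_sum, mul_left_comm c,
    mul_neg]

theorem lorentzProd_add_left (x y z : LorentzSpace d) :
    lorentzProd (x + y) z = lorentzProd x z + lorentzProd y z := by
  simp only [lorentzProd_comm _ z, lorentzProd_add_right]

theorem lorentzProd_smul_left (c : ℝ) (x y : LorentzSpace d) :
    lorentzProd (c • x) y = c * lorentzProd x y := by
  simp only [lorentzProd_comm _ y, lorentzProd_smul_right]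

theorem lorentzProd_sub_right (x y z : LorentzSpace d) :
    lorentzProd x (y - z) = lorentzProd x y - lorentzProd x z := by
  rw [sub_eq_add_neg, ← neg_one_smul ℝ z, lorentzProd_add_right, lorentzProd_smul_right]
  ring

theorem lorentzProd_sub_left (x y z : LorentzSpace d) :
    lorentzProd (x - y) z = lorentzProd x z - lorentzProd y z := by
  simp only [lorentzProd_comm _ z, lorentzProd_sub_right]

/-- The linear functional `lorentzProd y`. -/
noncomputable def lorentzFunctional (y : LorentzSpace d) : LorentzSpace d →ₗ[ℝ] ℝ where
  toFun := lorentzProd y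
  map_add' := lorentzProd_add_right y
  map_smul' c x := lorentzProd_smul_right c y x

/-- The unit vector of the time axis. -/
noncomputable def timeVector (d : ℕ) : LorentzSpace d := EuclideanSpace.single 0 1

theorem lorentzProd_timeVector (x : LorentzSpace d) : lorentzProd x (timeVector d) = -x 0 := by
  simp [lorentzProd, timeVector, Fin.succ_ne_zero]

theorem lorentzProd_self (x : LorentzSpace d) :
    lorentzProd x x = -(x 0 * x 0) + ∑ i : Fin d, x i.succ ^ 2 := by
  simp only [lorentzProd, sq]

theorem norm_sq_eq_lorentzProd (x : LorentzSpace d) :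
    ‖x‖ ^ 2 = lorentzProd x x + 2 * x 0 ^ 2 := by
  rw [EuclideanSpace.norm_sq_eq, Fin.sum_univ_succ, lorentzProd_self]
  simp only [Real.norm_eq_abs, sq_abs]
  ring

theorem eq_zero_of_lorentzProd_self_nonpos {x : LorentzSpace d} (hx : lorentzProd x x ≤ 0)
    (h0 : x 0 = 0) : x = 0 := by
  have := norm_sq_eq_lorentzProd x
  rw [h0] at this
  rw [← norm_eq_zero, ← sq_eq_zero_iff]
  exact le_antisymm (by linarith) (sq_nonneg _)

theorem lorentzProd_self_nonneg_of_orthogonal {x y : LorentzSpace d} (hy : lorentzProd y y ≤ 0)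
    (hy0 : y ≠ 0) (hxy : lorentzProd y x = 0) : 0 ≤ lorentzProd x x := by
  have hne : y 0 ≠ 0 := fun h => hy0 (eq_zero_of_lorentzProd_self_nonpos hy h)
  have hcs := Finset.sum_mul_sq_le_sq_mul_sq Finset.univ (fun i : Fin d => y i.succ)
    (fun i => x i.succ)
  rw [lorentzProd_self] at hy ⊢
  have h1 : ∑ i : Fin d, y i.succ * x i.succ = y 0 * x 0 := by
    unfold lorentzProd at hxy
    linarith
  rw [h1] at hcs
  have hs : 0 ≤ ∑ i : Fin d, x i.succ ^ 2 := Finset.sum_nonneg fun i _ => sq_nonneg _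
  have h2 : (y 0 * x 0) ^ 2 ≤ y 0 ^ 2 * ∑ i : Fin d, x i.succ ^ 2 :=
    hcs.trans (mul_le_mul_of_nonneg_right (by linarith [sq (y 0)]) hs)
  rw [mul_pow] at h2
  have h3 := le_of_mul_le_mul_left h2 (by positivity)
  linarith [sq (x 0)]

theorem eq_smul_of_lorentzProd_eq_zero {x y : LorentzSpace d} (hx : lorentzProd x x ≤ 0)
    (hx0 : x ≠ 0) (hy : lorentzProd y y ≤ 0) (hxy : lorentzProd y x = 0) :
    ∃ c : ℝ, y = c • x := by
  have hne : x 0 ≠ 0 := fun h => hx0 (eq_zero_of_lorentzProd_self_nonpos hx h)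
  -- The scalar cancels the time coordinate of `y - c • x`, which is still not spacelike because `x`
  -- and `y` are orthogonal.
  refine ⟨y 0 / x 0, sub_eq_zero.1 (eq_zero_of_lorentzProd_self_nonpos ?_ ?_)⟩
  · simp only [lorentzProd_sub_left, lorentzProd_sub_right, lorentzProd_smul_left,
      lorentzProd_smul_right, hxy, lorentzProd_comm x y]
    have := mul_nonpos_of_nonneg_of_nonpos (mul_self_nonneg (y 0 / x 0)) hx
    linarith
  · simp [hne]

theorem lorentzProd_nonpos_of_mem_lightCone {x y : LorentzSpace d} (hx : x ∈ lightCone d)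
    (hy : y ∈ lightCone d) : lorentzProd x y ≤ 0 := by
  obtain ⟨hx, hx0⟩ := hx
  obtain ⟨hy, hy0⟩ := hy
  have hcs := Finset.sum_mul_sq_le_sq_mul_sq Finset.univ (fun i : Fin d => x i.succ)
    (fun i => y i.succ)
  rw [lorentzProd_self] at hx hy
  have hs : 0 ≤ ∑ i : Fin d, y i.succ ^ 2 := Finset.sum_nonneg fun i _ => sq_nonneg _
  have h1 : (∑ i : Fin d, x i.succ * y i.succ) ^ 2 ≤ (x 0 * y 0) ^ 2 := by
    rw [mul_pow]
    exact hcs.trans (mul_le_mul (by linarith [sq (x 0)]) (by linarith [sq (y 0)]) hs (sq_nonneg _))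
  have h2 := abs_le_of_sq_le_sq h1 (mul_nonneg hx0 hy0)
  unfold lorentzProd
  linarith [le_of_abs_le h2]

theorem timeVector_mem_lightCone : timeVector d ∈ lightCone d := by
  have h : timeVector d 0 = 1 := by simp [timeVector]
  refine ⟨?_, by rw [h]; exact zero_le_one⟩
  rw [lorentzProd_timeVector, h]
  norm_num

theorem smul_mem_lightCone {x : LorentzSpace d} (hx : x ∈ lightCone d) {c : ℝ} (hc : 0 ≤ c) :
    c • x ∈ lightCone d := by
  refine ⟨?_, mul_nonneg hc hx.2⟩
  rw [lorentzProd_smul_left, lorentzProd_smul_right, ← mul_assoc]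
  exact mul_nonpos_of_nonneg_of_nonpos (mul_self_nonneg c) hx.1

/-- The vector with time coordinate `t` and the space coordinates of `x`. -/
noncomputable def withTime (t : ℝ) (x : LorentzSpace d) : LorentzSpace d :=
  WithLp.toLp 2 (Fin.cons t fun i : Fin d => x i.succ)

@[simp] theorem withTime_zero (t : ℝ) (x : LorentzSpace d) : withTime t x 0 = t := rfl

@[simp] theorem withTime_succ (t : ℝ) (x : LorentzSpace d) (i : Fin d) :
    withTime t x i.succ = x i.succ := rfl

theorem withTime_sqrt_mem_lightCone (x : LorentzSpace d) :
    withTime (√(∑ i : Fin d, x i.succ ^ 2)) x ∈ lightCone d := by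
  have hs : 0 ≤ ∑ i : Fin d, x i.succ ^ 2 := Finset.sum_nonneg fun i _ => sq_nonneg _
  refine ⟨?_, Real.sqrt_nonneg _⟩
  rw [lorentzProd_self]
  simp only [withTime_zero, withTime_succ]
  rw [Real.mul_self_sqrt hs]
  linarith

theorem lorentzProd_withTime (t : ℝ) (x : LorentzSpace d) :
    lorentzProd x (withTime t x) = -(x 0 * t) + ∑ i : Fin d, x i.succ ^ 2 := by
  simp only [lorentzProd, withTime_zero, withTime_succ, sq]

/-- The light cone is self-dual. -/
theorem exists_mem_lightCone_of_nonpos {ℓ : LorentzSpace d →ₗ[ℝ] ℝ}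
    (hℓ : ∀ x ∈ ballB d, ℓ x ≤ 0) : ∃ y ∈ lightCone d, ∀ x, ℓ x = lorentzProd y x := by
  have hcone : ∀ x ∈ lightCone d, ℓ x ≤ 0 := by
    intro x hx
    rcases eq_or_ne x 0 with rfl | hx0
    · rw [map_zero]
    · have hn : 0 < ‖x‖ := norm_pos_iff.2 hx0
      have := hℓ (‖x‖⁻¹ • x) ⟨smul_mem_lightCone hx (inv_nonneg.2 hn.le), by
        simp [norm_smul, hx0]⟩
      rw [map_smul, smul_eq_mul] at this
      exact nonpos_of_mul_nonpos_right this (inv_pos.2 hn)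
  let y : LorentzSpace d := WithLp.toLp 2 (Fin.cons (-ℓ (EuclideanSpace.single 0 1))
    fun i : Fin d => ℓ (EuclideanSpace.single i.succ 1))
  have hy : ∀ x, ℓ x = lorentzProd y x := by
    intro x
    have h := congrArg ℓ ((EuclideanSpace.basisFun (Fin (d + 1)) ℝ).sum_repr x)
    simp only [EuclideanSpace.basisFun_repr, EuclideanSpace.basisFun_apply,
      Fin.sum_univ_succ] at h
    rw [← h, map_add, map_sum]
    simp only [map_smul, smul_eq_mul]
    simp only [lorentzProd, y, Fin.cons_zero, Fin.cons_succ, mul_comm]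
    ring
  have hs : 0 ≤ ∑ i : Fin d, y i.succ ^ 2 := Finset.sum_nonneg fun i _ => sq_nonneg _
  have hy0 : 0 ≤ y 0 := by
    have := hcone _ timeVector_mem_lightCone
    rw [hy, lorentzProd_timeVector] at this
    linarith
  refine ⟨y, ⟨?_, hy0⟩, hy⟩
  -- Testing against the lightlike vector with the same space part as `y` gives `s ^ 2 ≤ y 0 * s`,
  -- where `s` is the length of that part.
  have h := hcone _ (withTime_sqrt_mem_lightCone y)
  rw [hy, lorentzProd_withTime] at h
  rw [lorentzProd_self]
  set s := √(∑ i : Fin d, y i.succ ^ 2) with hsdef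
  have hss : s ^ 2 = ∑ i : Fin d, y i.succ ^ 2 := Real.sq_sqrt hs
  have hs0 : 0 ≤ s := Real.sqrt_nonneg _
  rw [← hss] at h ⊢
  rcases hs0.eq_or_lt with h0 | h0
  · rw [← h0]
    nlinarith
  · have : s ≤ y 0 := by
      by_contra! hlt
      nlinarith
    nlinarith

theorem continuous_lorentzProd (y : LorentzSpace d) : Continuous (lorentzProd y) :=
  (lorentzFunctional y).continuous_of_finiteDimensional

/-- Finitely many points of the light cone pierce the vectors that stay away from it. -/
theorem exists_finite_piercing (d : ℕ) :
    ∃ Y : Finset (LorentzSpace d), (∀ y ∈ Y, y ∈ lightCone d) ∧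
      ∀ w : LorentzSpace d, lorentzProd w w = 1 → w 0 ≤ 2 → ∃ y ∈ Y, 0 < lorentzProd y w := by
  classical
  -- If `lorentzProd w w = 1`, then `‖w‖ ^ 2 = 1 + 2 * w 0 ^ 2`, so `w 0 ≤ 2` gives `w 0 / ‖w‖ ≤ 2 /
  -- 3`. Since `2 / 3 < 1 / √2`, the compact set `K` misses the future light cone.
  let K : Set (LorentzSpace d) := Metric.sphere 0 1 ∩ {w | w 0 ≤ 2 / 3}
  have hK : IsCompact K := (isCompact_sphere 0 1).inter_right
    (isClosed_le (by fun_prop) continuous_const)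
  have hex : ∀ w ∈ K, ∃ y ∈ lightCone d, 0 < lorentzProd y w := by
    rintro w ⟨hw, hw0⟩
    have hw1 : ‖w‖ = 1 := by simpa using hw
    have hw0' : w 0 ≤ 2 / 3 := hw0
    have hnorm := norm_sq_eq_lorentzProd w
    rw [hw1, lorentzProd_self] at hnorm
    have hs : 0 ≤ ∑ i : Fin d, w i.succ ^ 2 := Finset.sum_nonneg fun i _ => sq_nonneg _
    have hmem := withTime_sqrt_mem_lightCone w
    have hprod := lorentzProd_withTime (√(∑ i : Fin d, w i.succ ^ 2)) w
    set s := √(∑ i : Fin d, w i.succ ^ 2) with hsdef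
    have hss : s ^ 2 = ∑ i : Fin d, w i.succ ^ 2 := Real.sq_sqrt hs
    have hs0 : 0 ≤ s := Real.sqrt_nonneg _
    rw [← hss] at hnorm hprod
    rcases hs0.eq_or_lt with h0 | h0
    · refine ⟨timeVector d, timeVector_mem_lightCone, ?_⟩
      rw [lorentzProd_comm, lorentzProd_timeVector]
      rw [← h0] at hnorm
      nlinarith
    · refine ⟨_, hmem, ?_⟩
      rw [lorentzProd_comm, hprod]
      have : w 0 < s := by
        by_contra! hlt
        nlinarith
      nlinarith
  choose! f hfL hf using hex
  obtain ⟨t, ht, hcover⟩ := hK.elim_nhds_subcover (fun w => {x | 0 < lorentzProd (f w) x})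
    (fun w hw => (isOpen_lt continuous_const (continuous_lorentzProd _)).mem_nhds (hf w hw))
  refine ⟨t.image f, fun y hy => ?_, fun w hw hw0 => ?_⟩
  · obtain ⟨w, hw, rfl⟩ := Finset.mem_image.1 hy
    exact hfL w (ht w hw)
  · have hnorm := norm_sq_eq_lorentzProd w
    rw [hw] at hnorm
    have hn : 0 < ‖w‖ := by
      refine norm_pos_iff.2 ?_
      rintro rfl
      simp at hnorm
    have hwK : ‖w‖⁻¹ • w ∈ K := by
      refine ⟨by simp [norm_smul, hn.ne'], ?_⟩
      show ‖w‖⁻¹ * w 0 ≤ 2 / 3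
      rw [inv_mul_le_iff₀ hn]
      by_contra! hlt
      nlinarith
    obtain ⟨v, hv, hvw⟩ := Set.mem_iUnion₂.1 (hcover hwK)
    refine ⟨f v, Finset.mem_image_of_mem f hv, ?_⟩
    have hvw' : 0 < lorentzProd (f v) (‖w‖⁻¹ • w) := hvw
    rw [lorentzProd_smul_right] at hvw'
    exact pos_of_mul_pos_right hvw' (inv_nonneg.2 hn.le)

/-- The Lorentz transformation that exchanges the future unit vectors `timeVector d` and `p`. -/
noncomputable def boost (p x : LorentzSpace d) : LorentzSpace d :=
  (2 * lorentzProd x (timeVector d + p) / lorentzProd (timeVector d + p) (timeVector d + p)) •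
    (timeVector d + p) - x

theorem lorentzProd_boost_right (p x y : LorentzSpace d) :
    lorentzProd y (boost p x) = lorentzProd (boost p y) x := by
  simp only [boost, lorentzProd_sub_left, lorentzProd_sub_right, lorentzProd_smul_left,
    lorentzProd_smul_right, lorentzProd_comm (timeVector d + p) x]
  ring

theorem lorentzProd_timeVector_self : lorentzProd (timeVector d) (timeVector d) = -1 := by
  rw [lorentzProd_timeVector]
  simp [timeVector]

theorem lorentzProd_timeVector_add_self {p : LorentzSpace d} (hp : lorentzProd p p = -1) :
    lorentzProd (timeVector d + p) (timeVector d + p) = -2 * (1 + p 0) := by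
  have h1 := lorentzProd_timeVector p
  have h2 := lorentzProd_comm (timeVector d) p
  rw [lorentzProd_add_left, lorentzProd_add_right, lorentzProd_add_right,
    lorentzProd_timeVector_self, hp, h2, h1]
  ring

theorem boost_boost {p : LorentzSpace d} (hp : lorentzProd p p = -1) (hp0 : 0 ≤ p 0)
    (x : LorentzSpace d) : boost p (boost p x) = x := by
  have hc := lorentzProd_timeVector_add_self hp
  have hne : lorentzProd (timeVector d + p) (timeVector d + p) ≠ 0 := by
    rw [hc]
    have : 0 < 1 + p 0 := by linarith
    nlinarith
  have h : lorentzProd (boost p x) (timeVector d + p) = lorentzProd x (timeVector d + p) := by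
    rw [boost, lorentzProd_sub_left, lorentzProd_smul_left, div_mul_cancel₀ _ hne]
    ring
  rw [boost, h, boost]
  abel

theorem lorentzProd_boost_boost {p : LorentzSpace d} (hp : lorentzProd p p = -1) (hp0 : 0 ≤ p 0)
    (x y : LorentzSpace d) : lorentzProd (boost p x) (boost p y) = lorentzProd x y := by
  rw [lorentzProd_boost_right, boost_boost hp hp0]

theorem boost_timeVector {p : LorentzSpace d} (hp : lorentzProd p p = -1) (hp0 : 0 ≤ p 0) :
    boost p (timeVector d) = p := by
  have h : 2 * lorentzProd (timeVector d) (timeVector d + p) =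
      lorentzProd (timeVector d + p) (timeVector d + p) := by
    rw [lorentzProd_timeVector_add_self hp, lorentzProd_add_right, lorentzProd_timeVector_self,
      lorentzProd_comm, lorentzProd_timeVector]
    ring
  have hne : lorentzProd (timeVector d + p) (timeVector d + p) ≠ 0 := by
    rw [lorentzProd_timeVector_add_self hp]
    have : 0 < 1 + p 0 := by linarith
    nlinarith
  rw [boost, h, div_self hne, one_smul]
  abel

theorem boost_apply_zero {p : LorentzSpace d} (hp : lorentzProd p p = -1) (hp0 : 0 ≤ p 0)
    (x : LorentzSpace d) : boost p x 0 = -lorentzProd x p := by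
  have := lorentzProd_timeVector (boost p x)
  rw [← lorentzProd_boost_right, boost_timeVector hp hp0] at this
  linarith

/-- A future unit vector from which none of the half-spaces is far away. -/
theorem exists_center {ι : Type*} (M : Finset ι) (g : ι → LorentzSpace d)
    (hg : ∀ i ∈ M, lorentzProd (g i) (g i) = 1)
    (hgg : ∀ i ∈ M, ∀ j ∈ M, |lorentzProd (g i) (g j)| ≤ 1) :
    ∃ p : LorentzSpace d, lorentzProd p p = -1 ∧ 0 ≤ p 0 ∧
      ∀ i ∈ M, -2 ≤ lorentzProd (g i) p := by
  by_cases hT : ∀ i ∈ M, g i 0 ≤ 0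
  · refine ⟨timeVector d, lorentzProd_timeVector_self, by simp [timeVector], fun i hi => ?_⟩
    rw [lorentzProd_timeVector]
    linarith [hT i hi]
  push Not at hT
  obtain ⟨i₀, hi₀, h0⟩ := hT
  obtain ⟨j, hj, hmax⟩ := Finset.exists_max_image M (fun i => g i 0) ⟨i₀, hi₀⟩
  set T := g j 0 with hTdef
  have hTpos : 0 < T := h0.trans_le (hmax i₀ hi₀)
  set q := √(1 + T ^ 2) with hq
  have hqq : q ^ 2 = 1 + T ^ 2 := Real.sq_sqrt (by positivity)
  have hqpos : 0 < q := Real.sqrt_pos.2 (by positivity)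
  -- The half-space of `g j` is the farthest from the time axis; the witness is the foot of the
  -- perpendicular from `timeVector d` to its boundary, normalized by `q`.
  refine ⟨q⁻¹ • (timeVector d + T • g j), ?_, ?_, fun i hi => ?_⟩
  · have h1 := lorentzProd_timeVector (g j)
    have h2 := lorentzProd_comm (timeVector d) (g j)
    rw [lorentzProd_smul_left, lorentzProd_smul_right, lorentzProd_add_left,
      lorentzProd_add_right, lorentzProd_add_right, lorentzProd_smul_left, lorentzProd_smul_left,
      lorentzProd_smul_right, lorentzProd_smul_right, lorentzProd_timeVector_self, hg j hj, h2, h1,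
      ← hTdef]
    field_simp
    linarith
  · refine mul_nonneg (inv_nonneg.2 hqpos.le) (add_nonneg ?_ ?_)
    · simp [timeVector]
    · exact mul_nonneg hTpos.le hTpos.le
  · rw [lorentzProd_smul_right, lorentzProd_add_right, lorentzProd_timeVector,
      lorentzProd_smul_right]
    have h1 := (abs_le.1 (hgg i hi j hj)).1
    have h2 := hmax i hi
    have h3 : T ≤ q := by
      by_contra! hlt
      nlinarith
    have h4 : -(2 * T) ≤ -(g i) 0 + T * lorentzProd (g i) (g j) := by
      have := mul_le_mul_of_nonneg_left h1 hTpos.le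
      linarith
    calc (-2 : ℝ) = q⁻¹ * (-(2 * q)) := by field_simp
      _ ≤ _ := mul_le_mul_of_nonneg_left (by linarith) (inv_nonneg.2 hqpos.le)

/-- Among many half-spaces whose boundaries pairwise meet in the ball, there are many that have a
point of the ball in their interiors. -/
theorem exists_deep_point (d : ℕ) : ∃ m : ℕ, ∀ (ι : Type) (M : Finset ι)
    (g : ι → LorentzSpace d), (∀ i ∈ M, lorentzProd (g i) (g i) = 1) →
    (∀ i ∈ M, ∀ j ∈ M, |lorentzProd (g i) (g j)| ≤ 1) → ∀ k : ℕ, m * k < M.card →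
    ∃ y ∈ lightCone d, ∃ S ⊆ M, k < S.card ∧ ∀ i ∈ S, 0 < lorentzProd y (g i) := by
  classical
  obtain ⟨Y, hYL, hY⟩ := exists_finite_piercing d
  refine ⟨Y.card, fun ι M g hg hgg k hk => ?_⟩
  obtain ⟨p, hp, hp0, hpM⟩ := exists_center M g hg hgg
  -- The boost moves `p` to the time axis, so the bound `-2` at `p` becomes time coordinate at most
  -- `2`.
  have hex : ∀ i ∈ M, ∃ y ∈ Y, 0 < lorentzProd y (boost p (g i)) := fun i hi =>
    hY _ (by rw [lorentzProd_boost_boost hp hp0, hg i hi])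
      (by rw [boost_apply_zero hp hp0]; linarith [hpM i hi])
  choose! f hfY hf using hex
  obtain ⟨y, hy, hcard⟩ := Finset.exists_lt_card_fiber_of_mul_lt_card_of_maps_to hfY hk
  have hpL : p ∈ lightCone d := ⟨by rw [hp]; norm_num, hp0⟩
  refine ⟨boost p y, ⟨?_, ?_⟩, _, Finset.filter_subset _ M, hcard, fun i hi => ?_⟩
  · rw [lorentzProd_boost_boost hp hp0]
    exact (hYL y hy).1
  · rw [boost_apply_zero hp hp0]
    exact neg_nonneg.2 (lorentzProd_nonpos_of_mem_lightCone (hYL y hy) hpL)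
  · obtain ⟨hiM, hiy⟩ := Finset.mem_filter.1 hi
    rw [← lorentzProd_boost_right, ← hiy]
    exact hf i hiM

end Lorentz

/-! ### Vertices of scribed neighborly polytopes, and the contradiction. -/

namespace SphericalPolytope

variable {d k : ℕ}

theorem exists_lightlike_of_edge {P : SphericalPolytope d}
    (hface : ∀ I : Finset (LorentzSpace d), (I : Set (LorentzSpace d)) ⊆ P.vertices →
      I.card ≤ k → ∃ F, P.IsFace F ∧ F ∩ P.vertices = (I : Set (LorentzSpace d)))
    (hk : 2 ≤ k) (havoid : ∀ F, P.IsKFace 1 F → P.StronglyAvoids F)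
    {v w : LorentzSpace d} (hv : v ∈ P.vertices) (hw : w ∈ P.vertices) (hvw : v ≠ w) :
    ∃ y : LorentzSpace d, y ≠ 0 ∧ lorentzProd y y ≤ 0 ∧ lorentzProd y v = 0 ∧
      lorentzProd y w = 0 ∧ ∀ u ∈ P.vertices, lorentzProd y u = 0 → u = v ∨ u = w := by
  classical
  have hcard : ({v, w} : Finset (LorentzSpace d)).card = 2 := Finset.card_pair hvw
  have hI : (({v, w} : Finset (LorentzSpace d)) : Set (LorentzSpace d)) ⊆ P.vertices := by
    intro x hx
    rcases (by simpa using hx : x = v ∨ x = w) with rfl | rfl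
    · exact hv
    · exact hw
  obtain ⟨F, hF, hFI⟩ := hface {v, w} hI (by omega)
  have hrank := finrank_span_face hface hI (by omega) hF hFI
  rw [hcard] at hrank
  obtain ⟨ℓ, hℓ0, -, hFℓ, hℓB⟩ := havoid F ⟨hF, hrank⟩
  obtain ⟨y, hy, hℓy⟩ := exists_mem_lightCone_of_nonpos hℓB
  have hmem : ∀ x, x = v ∨ x = w → x ∈ F := by
    intro x hx
    have : x ∈ F ∩ P.vertices := by
      rw [hFI]
      simpa using hx
    exact this.1
  have hzero : ∀ x ∈ F, lorentzProd y x = 0 := by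
    intro x hx
    rw [hFℓ] at hx
    rw [← hℓy]
    exact hx.2
  refine ⟨y, ?_, hy.1, hzero v (hmem v (Or.inl rfl)), hzero w (hmem w (Or.inr rfl)), ?_⟩
  · rintro rfl
    refine hℓ0 (LinearMap.ext fun x => ?_)
    rw [hℓy]
    simp [lorentzProd]
  · intro u hu hyu
    have h1 : u ∈ F ∩ P.vertices := by
      refine ⟨?_, hu⟩
      rw [hFℓ]
      exact ⟨mem_cone_of_mem_vertices hu, by rw [hℓy, hyu]⟩
    rw [hFI] at h1
    simpa using h1

/-- If `v` were not spacelike, every nonspacelike vector orthogonal to it would be a multiple of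
`v`. The hyperplanes of the edges `vw` and `vu` would coincide, although the first contains no
vertex but `v` and `w`. -/
theorem lorentzProd_self_pos_of_vertex {P : SphericalPolytope d}
    (hface : ∀ I : Finset (LorentzSpace d), (I : Set (LorentzSpace d)) ⊆ P.vertices →
      I.card ≤ k → ∃ F, P.IsFace F ∧ F ∩ P.vertices = (I : Set (LorentzSpace d)))
    (hk : 2 ≤ k) (havoid : ∀ F, P.IsKFace 1 F → P.StronglyAvoids F)
    {v w u : LorentzSpace d} (hv : v ∈ P.vertices) (hw : w ∈ P.vertices) (hu : u ∈ P.vertices)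
    (hvw : v ≠ w) (hvu : v ≠ u) (hwu : w ≠ u) : 0 < lorentzProd v v := by
  by_contra! hcon
  have hv0 := ne_zero_of_mem_vertices hv
  obtain ⟨y, hy0, hy, hyv, hyw, hyV⟩ := exists_lightlike_of_edge hface hk havoid hv hw hvw
  obtain ⟨z, hz0, hz, hzv, hzu, -⟩ := exists_lightlike_of_edge hface hk havoid hv hu hvu
  obtain ⟨a, rfl⟩ := eq_smul_of_lorentzProd_eq_zero hcon hv0 hy hyv
  obtain ⟨b, rfl⟩ := eq_smul_of_lorentzProd_eq_zero hcon hv0 hz hzv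
  have hb : b ≠ 0 := by rintro rfl; simp at hz0
  rw [lorentzProd_smul_left] at hzu
  have h := hyV u hu (by
    rw [lorentzProd_smul_left, (mul_eq_zero.1 hzu).resolve_left hb, mul_zero])
  rcases h with h | h
  · exact hvu h.symm
  · exact hwu h.symm

/-- The form is positive semidefinite on the orthogonal complement of `y`; apply this to `v + w` and
`v - w`. -/
theorem abs_lorentzProd_le_one {v w y : LorentzSpace d} (hv : lorentzProd v v = 1)
    (hw : lorentzProd w w = 1) (hy0 : y ≠ 0) (hy : lorentzProd y y ≤ 0)
    (hyv : lorentzProd y v = 0) (hyw : lorentzProd y w = 0) : |lorentzProd v w| ≤ 1 := by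
  have h1 := lorentzProd_self_nonneg_of_orthogonal hy hy0
    (x := v + w) (by rw [lorentzProd_add_right, hyv, hyw, add_zero])
  have h2 := lorentzProd_self_nonneg_of_orthogonal hy hy0
    (x := v - w) (by rw [lorentzProd_sub_right, hyv, hyw, sub_zero])
  simp only [lorentzProd_add_left, lorentzProd_add_right, lorentzProd_sub_left,
    lorentzProd_sub_right, hv, hw, lorentzProd_comm w v] at h1 h2
  exact abs_le.2 ⟨by linarith, by linarith⟩

theorem exists_not_isScribed (d : ℕ) (hk : 2 ≤ k) :
    ∃ N : ℕ, ∀ Q : SphericalPolytope d, Q.IsNeighborly k → N ≤ Q.vertices.ncard →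
      ¬ Q.IsScribed 1 k := by
  classical
  obtain ⟨m, hm⟩ := exists_deep_point d
  -- `m * k` serves the pigeonhole, `2 * k` the faces on fewer than `k` vertices, and `3` provides
  -- two further vertices beside any given one.
  refine ⟨m * k + 2 * k + 3, fun Q hQ hN => ?_⟩
  rintro ⟨havoid, hcut⟩
  have hface := hQ.exists_face_of_card_le (by omega) (by omega)
  have hfin : Q.vertices.Finite := Set.finite_of_ncard_pos (by omega)
  obtain ⟨V, hV⟩ := hfin.exists_finset_coe
  rw [← hV, Set.ncard_coe_finset] at hN
  have hmem : ∀ v ∈ V, v ∈ Q.vertices := fun v hv => by rw [← hV]; exact hv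
  have hpos : ∀ v ∈ V, 0 < lorentzProd v v := by
    intro v hv
    obtain ⟨w, hw, hwv⟩ := Finset.exists_mem_notMem_of_card_lt_card
      (s := {v}) (t := V) (by rw [Finset.card_singleton]; omega)
    obtain ⟨u, hu, huv⟩ := Finset.exists_mem_notMem_of_card_lt_card
      (s := {v, w}) (t := V) (lt_of_le_of_lt Finset.card_le_two (by omega))
    simp only [Finset.mem_singleton, Finset.mem_insert, not_or] at hwv huv
    exact lorentzProd_self_pos_of_vertex hface hk havoid (hmem v hv) (hmem w hw) (hmem u hu)
      (Ne.symm hwv) (Ne.symm huv.1) (Ne.symm huv.2)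
  let g : LorentzSpace d → LorentzSpace d := fun v => (√(lorentzProd v v))⁻¹ • v
  have hg : ∀ v ∈ V, lorentzProd (g v) (g v) = 1 := by
    intro v hv
    have h1 := hpos v hv
    simp only [g, lorentzProd_smul_left, lorentzProd_smul_right]
    rw [← mul_assoc, ← mul_inv, Real.mul_self_sqrt h1.le, inv_mul_cancel₀ h1.ne']
  have hgg : ∀ v ∈ V, ∀ w ∈ V, |lorentzProd (g v) (g w)| ≤ 1 := by
    intro v hv w hw
    by_cases hvw : v = w
    · rw [← hvw, hg v hv, abs_one]
    · obtain ⟨y, hy0, hy, hyv, hyw, -⟩ :=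
        exists_lightlike_of_edge hface hk havoid (hmem v hv) (hmem w hw) hvw
      exact abs_lorentzProd_le_one (hg v hv) (hg w hw) hy0 hy
        (by rw [lorentzProd_smul_right, hyv, mul_zero])
        (by rw [lorentzProd_smul_right, hyw, mul_zero])
  obtain ⟨y, hy, S, hSV, hSk, hS⟩ := hm _ V g hg hgg k (by omega)
  obtain ⟨F, hF, hFy, hFpos⟩ := exists_kFace_in_halfspace hface (by omega)
    (ℓ := lorentzFunctional y) (M := S) (fun v hv => hmem v (hSV hv)) hSk (fun v hv => by
      have h := hS v hv
      simp only [g, lorentzProd_smul_right] at h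
      exact pos_of_mul_pos_right h (inv_nonneg.2 (Real.sqrt_nonneg _)))
  exact not_stronglyCuts_of_nonneg hFy hFpos
    (fun x hx => lorentzProd_nonpos_of_mem_lightCone hy hx.1) (hcut F hF)

end SphericalPolytope

theorem mainTheorem9 (d k : ℕ) (hd : 4 ≤ d) (hk : 2 ≤ k) (hkd : k ≤ d - 1) :
    ∃ N : ℕ, ∀ P : SphericalPolytope d,
      P.IsNeighborly k → N ≤ P.vertices.ncard → ¬ P.IsScribable 1 k := by
  obtain ⟨N, hN⟩ := SphericalPolytope.exists_not_isScribed d hk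
  refine ⟨N, fun P hP hPN => ?_⟩
  rintro ⟨Q, hPQ, hQ⟩
  obtain ⟨hQk, hcard⟩ := hPQ.isNeighborly_and_ncard hP
  exact hN Q hQk (hcard ▸ hPN) hQ
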